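/- An $n\times n$ matrix of $n^2$ integers is a *general magic square of order $n$* if all of its row sums, its column sums, the sum of its main diagonal and the sum of its back diagonal are equal. It is a *magic square of order $n$* if moreover its entries are $n^2$ consecutive integers, each occurring exactly once. An *ASMS$(n)$* (magic square with all subsquares of possible orders) is a magic square of order $n$ that contains, for each integer $k$ with $3\le k\le n-2$, a general magic square of order $k$ as a subsquare, i.e. as a block of $k$ consecutive rows and $k$ consecutive columns. **Theorem 1.1.** For every positive integer $n\equiv\pm3\pmod{18}$ there exists an ASMS$(n)$. (For $n=3$ the condition on subsquares is empty.) -/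

import Mathlib

/-- A square integer matrix of order `n` is a general magic square if all row sums, all column
sums, the sum of the main diagonal and the sum of the back diagonal are equal. -/
def IsGeneralMagicSquare {n : ℕ} (A : Matrix (Fin n) (Fin n) ℤ) : Prop :=
  ∃ s : ℤ, (∀ i, ∑ j, A i j = s) ∧ (∀ j, ∑ i, A i j = s) ∧
    ∑ i, A i i = s ∧ ∑ i, A i (Fin.rev i) = s

/-- A magic square of order `n` is a general magic square whose `n ^ 2` entries are
`n ^ 2` consecutive integers, each occurring exactly once. -/
def IsMagicSquare {n : ℕ} (A : Matrix (Fin n) (Fin n) ℤ) : Prop :=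
  IsGeneralMagicSquare A ∧
    ∃ a : ℤ, Set.BijOn (fun p : Fin n × Fin n => A p.1 p.2) Set.univ (Set.Ico a (a + (n : ℤ) ^ 2))

/-- The subsquare of order `k` of `A` formed by the consecutive rows `r, …, r + k - 1` and the
consecutive columns `c, …, c + k - 1` (counted from `0`). -/
def subsquare {n : ℕ} (A : Matrix (Fin n) (Fin n) ℤ) (k r c : ℕ) (hr : r + k ≤ n)
    (hc : c + k ≤ n) : Matrix (Fin k) (Fin k) ℤ :=
  fun i j => A ⟨r + i, by omega⟩ ⟨c + j, by omega⟩

/-- A magic square with all subsquares of possible orders: it contains a general magic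
subsquare of each order `k` with `3 ≤ k ≤ n - 2`. -/
def IsASMS {n : ℕ} (A : Matrix (Fin n) (Fin n) ℤ) : Prop :=
  IsMagicSquare A ∧
    ∀ k : ℕ, 3 ≤ k → k + 2 ≤ n →
      ∃ (r c : ℕ) (hr : r + k ≤ n) (hc : c + k ≤ n),
        IsGeneralMagicSquare (subsquare A k r c hr hc)

/-! Entries are centred: every magic sum is 0 and the values to be attained are -N, …, N with 2N + 1
= n². Attaining them all in n² cells forces each to occur once, so distinctness is never checked
separately. Orders 3, 15 and 21 are explicit tables. An odd order n = 2M + 13 with M ≥ 10 is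
obtained by bordering a 13 × 13 core M times.

Level k adds two columns that are negatives of each other and two rows that are negatives of each
other, apart from the 2 × 2 corner where they meet. Old rows and columns keep sum 0 and the corner
adds 0 to the main diagonal, so only the sums of the new lines must balance the corner
(`sum_colEntry`, `sum_rowEntry`). All leading blocks of odd order at least 13 then have zero row,
column and main diagonal sums. Even orders from 12 on come from deleting the first three rows and
columns, which is harmless because the first three entries of every later line sum to 0, as does the
initial diagonal triple. The core supplies orders below 12.

These back diagonals are invariant under transposition, so apart from a central entry they depend
only on the sums of transposed entries, i.e. on `pairSum`. It follows a pattern of period 4 whose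
contributions cancel, except for two large values near the corner that balance the central entry.

The magnitudes are still free. A pair with sum ±g consists of x and x + g up to sign, and the x are
chosen so that all magnitudes tile an interval: the core; four per level next to it; three families,
each a stretch of 84 filled by blocks of four, flanked by pairs that move outwards as k grows; and
finally the remaining blocks of four. -/

/-! ### Squares cut out of an infinite array -/

/-- The order-`k` block of the array `e` with upper left corner `(r, c)` has vanishing row,
column and diagonal sums. -/
def ZeroBlock (e : ℕ → ℕ → ℤ) (k r c : ℕ) : Prop :=
  (∀ i < k, ∑ j ∈ Finset.range k, e (r + i) (c + j) = 0) ∧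
  (∀ j < k, ∑ i ∈ Finset.range k, e (r + i) (c + j) = 0) ∧
  ∑ i ∈ Finset.range k, e (r + i) (c + i) = 0 ∧
  ∑ i ∈ Finset.range k, e (r + i) (c + (k - 1 - i)) = 0

instance (e : ℕ → ℕ → ℤ) (k r c : ℕ) : Decidable (ZeroBlock e k r c) := by
  unfold ZeroBlock; infer_instance

/-- The leading `n × n` block of an infinite array. -/
def leadingBlock (n : ℕ) (e : ℕ → ℕ → ℤ) : Matrix (Fin n) (Fin n) ℤ := fun i j => e i j

theorem ZeroBlock.isGeneralMagicSquare_subsquare {e : ℕ → ℕ → ℤ} {n k r c : ℕ}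
    (h : ZeroBlock e k r c) (hr : r + k ≤ n) (hc : c + k ≤ n) :
    IsGeneralMagicSquare (subsquare (leadingBlock n e) k r c hr hc) := by
  obtain ⟨h1, h2, h3, h4⟩ := h
  refine ⟨0, fun i => ?_, fun j => ?_, ?_, ?_⟩
  · simpa [subsquare, leadingBlock, Finset.sum_range] using h1 i i.2
  · simpa [subsquare, leadingBlock, Finset.sum_range] using h2 j j.2
  · simpa [subsquare, leadingBlock, Finset.sum_range] using h3
  · rw [Finset.sum_range] at h4
    rw [← h4]
    refine Finset.sum_congr rfl fun i _ => ?_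
    simp only [subsquare, leadingBlock, Fin.val_rev]
    congr 2
    omega

theorem ZeroBlock.isGeneralMagicSquare {e : ℕ → ℕ → ℤ} {n : ℕ} (h : ZeroBlock e n 0 0) :
    IsGeneralMagicSquare (leadingBlock n e) := by
  have := h.isGeneralMagicSquare_subsquare (n := n) (by omega) (by omega)
  have hs : subsquare (leadingBlock n e) n 0 0 (by omega) (by omega) = leadingBlock n e := by
    ext i j
    simp [subsquare, leadingBlock]
  rwa [hs] at this

/-- Pigeonhole: the image contains the N integers of the interval but has at most N elements, so it
equals the interval and no value repeats. -/
theorem bijOn_Ico_of_subset_range {α : Type*} [Fintype α] (f : α → ℤ) (a : ℤ) (N : ℕ)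
    (hN : Fintype.card α = N) (h : ∀ v, a ≤ v → v < a + N → ∃ x, f x = v) :
    Set.BijOn f Set.univ (Set.Ico a (a + N)) := by
  classical
  have hsub : Finset.Ico a (a + N) ⊆ Finset.univ.image f := by
    intro v hv
    rw [Finset.mem_Ico] at hv
    obtain ⟨x, hx⟩ := h v hv.1 hv.2
    exact Finset.mem_image.2 ⟨x, Finset.mem_univ _, hx⟩
  have hcard : (Finset.univ.image f).card ≤ (Finset.Ico a (a + N)).card := by
    refine Finset.card_image_le.trans ?_
    simp [hN]
  have heq := Finset.eq_of_subset_of_card_le hsub hcard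
  have hinj : Set.InjOn f (Finset.univ : Finset α) := by
    rw [← Finset.card_image_iff, ← heq]
    simp [hN]
  refine ⟨fun x _ => ?_, by simpa using hinj, fun v hv => ?_⟩
  · have : f x ∈ Finset.Ico a (a + N) := by
      rw [heq]; exact Finset.mem_image_of_mem f (Finset.mem_univ x)
    simpa using this
  · obtain ⟨x, hx⟩ := h v hv.1 hv.2
    exact ⟨x, trivial, hx⟩

/-- A criterion for the leading block of an array to be an ASMS: the entries exhaust an interval
of the right length symmetric about zero, and there are enough zero-sum blocks. -/
theorem isASMS_leadingBlock {e : ℕ → ℕ → ℤ} {n N : ℕ} (hN : n ^ 2 = 2 * N + 1)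
    (hall : ZeroBlock e n 0 0)
    (hsurj : ∀ v : ℤ, -N ≤ v → v ≤ N → ∃ i < n, ∃ j < n, e i j = v)
    (hsub : ∀ k, 3 ≤ k → k + 2 ≤ n → ∃ r c, r + k ≤ n ∧ c + k ≤ n ∧ ZeroBlock e k r c) :
    IsASMS (leadingBlock n e) := by
  refine ⟨⟨hall.isGeneralMagicSquare, -N, ?_⟩, fun k h3 hk => ?_⟩
  · have hN' : ((n : ℤ) ^ 2) = ((n ^ 2 : ℕ) : ℤ) := by push_cast; rfl
    rw [hN']
    refine bijOn_Ico_of_subset_range _ _ _ (by simp [sq]) fun v h1 h2 => ?_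
    have h3 : ((n ^ 2 : ℕ) : ℤ) = 2 * N + 1 := by exact_mod_cast hN
    obtain ⟨i, hi, j, hj, hij⟩ := hsurj v h1 (by omega)
    exact ⟨(⟨i, hi⟩, ⟨j, hj⟩), hij⟩
  · obtain ⟨r, c, hr, hc, h⟩ := hsub k h3 hk
    exact ⟨r, c, hr, hc, h.isGeneralMagicSquare_subsquare hr hc⟩

/-! ### Explicit squares -/

/-- The infinite array extending a finite table by zeros. -/
def tableArray (L : List (List ℤ)) (i j : ℕ) : ℤ := (L.getD i []).getD j 0

/-- The upper left corner of the zero-sum block of order `k` in the explicit tables. -/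
def cornerPosition (k : ℕ) : ℕ × ℕ :=
  if k = 3 then (0, 3) else if k = 5 then (5, 1) else if k % 2 = 1 then (0, 0) else (3, 3)

theorem exists_mem_tableArray {L : List (List ℤ)} {n : ℕ} (hL : L.length = n)
    (hrow : ∀ r ∈ L, r.length = n) {v : ℤ} (hv : v ∈ L.flatten) :
    ∃ i < n, ∃ j < n, tableArray L i j = v := by
  obtain ⟨r, hr, hvr⟩ := List.mem_flatten.1 hv
  obtain ⟨i, hi, rfl⟩ := List.mem_iff_getElem.1 hr
  obtain ⟨j, hj, rfl⟩ := List.mem_iff_getElem.1 hvr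
  refine ⟨i, by omega, j, by rw [← hrow _ hr]; exact hj, ?_⟩
  simp [tableArray, hi, hj]

/-- Every integer of absolute value at most `N` occurs in the table. -/
def Exhausts (L : List (List ℤ)) (N : ℕ) : Prop :=
  ∀ t < 2 * N + 1, ((t : ℤ) - N) ∈ L.flatten

instance (L : List (List ℤ)) (N : ℕ) : Decidable (Exhausts L N) := by
  unfold Exhausts; infer_instance

theorem Exhausts.exists_eq {L : List (List ℤ)} {n N : ℕ} (h : Exhausts L N) (hL : L.length = n)
    (hrow : ∀ r ∈ L, r.length = n) {v : ℤ} (h1 : -N ≤ v) (h2 : v ≤ N) :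
    ∃ i < n, ∃ j < n, tableArray L i j = v := by
  refine exists_mem_tableArray hL hrow ?_
  have := h (v + N).toNat (by omega)
  rwa [show (((v + N).toNat : ℕ) : ℤ) - N = v by omega] at this

theorem isASMS_of_table {L : List (List ℤ)} {n N : ℕ} (hN : n ^ 2 = 2 * N + 1)
    (hL : L.length = n) (hrow : ∀ r ∈ L, r.length = n) (hex : Exhausts L N)
    (hall : ZeroBlock (tableArray L) n 0 0)
    (hsub : ∀ k < n - 1, 3 ≤ k →
      (cornerPosition k).1 + k ≤ n ∧ (cornerPosition k).2 + k ≤ n ∧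
        ZeroBlock (tableArray L) k (cornerPosition k).1 (cornerPosition k).2) :
    IsASMS (leadingBlock n (tableArray L)) := by
  refine isASMS_leadingBlock hN hall (fun v h1 h2 => hex.exists_eq hL hrow h1 h2)
    fun k h3 hk => ?_
  obtain ⟨h1, h2, h⟩ := hsub k (by omega) h3
  exact ⟨_, _, h1, h2, h⟩

def table3 : List (List ℤ) := [[3, -4, 1], [-2, 0, 2], [-1, 4, -3]]

theorem exists_isASMS_three : ∃ A : Matrix (Fin 3) (Fin 3) ℤ, IsASMS A :=
  ⟨_, isASMS_of_table (L := table3) (N := 4) (by norm_num) rfl (by decide) (by decide)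
    (by decide) (by decide)⟩

def table15 : List (List ℤ) := [
    [30, 56, -48, 100, -111, 11, -38, 71, -71, 84, -84, 46, -46, 9, -9],
    [-40, 38, 32, -89, 0, 89, -30, -55, 55, 10, -10, 64, -64, -63, 63],
    [-61, 61, -68, -11, 111, -100, 68, -16, 16, -94, 94, -110, 110, 54, -54],
    [-42, -25, 67, -90, 24, 41, 25, -47, 47, 97, -97, -14, 14, 104, -104],
    [48, -31, -17, 17, 5, -62, 40, 45, -45, 26, -26, 70, -70, -86, 86],
    [88, -32, -56, 31, -5, 62, -88, -81, 81, 92, -92, -80, 80, -51, 51],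
    [-23, -67, 90, 42, -24, -41, 23, -13, 13, 19, -19, 108, -108, 78, -78],
    [4, -105, 101, -36, 1, 39, -60, 76, -20, 66, -66, -58, 58, -107, 107],
    [-4, 105, -101, 36, -1, -39, 60, 20, -76, -79, 79, 102, -102, 59, -59],
    [-65, 99, -34, -73, 29, -21, 77, 37, -52, -109, 112, 12, -12, 44, -44],
    [65, -99, 34, 73, -29, 21, -77, -37, 52, -112, 109, -22, 22, 28, -28],
    [18, -87, 69, 27, -82, -95, 98, -53, 49, 15, -7, -35, 83, -85, 85],
    [-18, 87, -69, -27, 82, 95, -98, 53, -49, -15, 7, -83, 35, 74, -74],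
    [75, -72, -3, 50, 93, 103, -57, -43, -8, 2, 96, -106, -6, -91, -33],
    [-75, 72, 3, -50, -93, -103, 57, 43, 8, -2, -96, 106, 6, 33, 91]]

theorem exists_isASMS_fifteen : ∃ A : Matrix (Fin 15) (Fin 15) ℤ, IsASMS A :=
  ⟨_, isASMS_of_table (L := table15) (N := 112) (by norm_num) rfl (by decide +kernel)
    (by decide +kernel) (by decide +kernel) (by decide +kernel)⟩

def table21 : List (List ℤ) := [
    [30, 56, -48, 100, -111, 11, -38, 179, -179, -4, 4, -79, 79, -6, 6, -190, 190, -107, 107, -110, 110],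
    [-40, 38, 32, -89, 0, 89, -30, -3, 3, -115, 115, -92, 92, 22, -22, 199, -199, -106, 106, -101, 101],
    [-61, 61, -68, -11, 111, -100, 68, -176, 176, 119, -119, 171, -171, -16, 16, -9, 9, 213, -213, 211, -211],
    [-42, -25, 67, -90, 24, 41, 25, -170, 170, 137, -137, -20, 20, -139, 139, -127, 127, 96, -96, -155, 155],
    [48, -31, -17, 17, 5, -62, 40, -78, 78, 54, -54, 70, -70, -193, 193, 201, -201, -84, 84, 141, -141],
    [88, -32, -56, 31, -5, 62, -88, -129, 129, 7, -7, 104, -104, 80, -80, 216, -216, 209, -209, 164, -164],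
    [-23, -67, 90, 42, -24, -41, 23, 114, -114, -147, 147, -205, 205, 215, -215, -81, 81, -178, 178, 37, -37],
    [1, -52, 51, -86, -49, 136, -126, 194, -69, -157, 157, 116, -116, 174, -174, 113, -113, -77, 77, -132, 132],
    [-1, 52, -51, 86, 49, -136, 126, 69, -194, 181, -181, -72, 72, 168, -168, -177, 177, 169, -169, 109, -109],
    [-65, 99, -34, -73, 29, -21, 66, -186, -60, 85, 160, -202, 202, -207, 207, -39, 39, 33, -33, -83, 83],
    [65, -99, 34, 73, -29, 21, -66, 186, 60, -160, -85, 191, -191, -47, 47, -218, 218, 57, -57, 214, -214],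
    [133, 10, -143, 188, 165, 185, 50, 175, -162, -140, -167, -138, -156, 102, -102, 142, -142, -135, 135, 158, -158],
    [-133, -10, 143, -188, -165, -185, -50, -175, 162, 140, 167, 156, 138, -35, 35, 159, -159, -183, 183, -63, 63],
    [58, -219, 161, -36, -2, -19, -172, 145, 149, 94, -124, -151, -130, 64, 182, -112, 112, -197, 197, -220, 220],
    [-58, 219, -161, 36, 2, 19, 172, -145, -149, -94, 124, 151, 130, -182, -64, -148, 148, -59, 59, -98, 98],
    [-212, 121, 91, -87, 128, 95, -117, -134, 146, 144, -196, -8, 97, -43, 210, -82, -153, 13, -13, -200, 200],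
    [212, -121, -91, 87, -128, -95, 117, 134, -146, -144, 196, 8, -97, 43, -210, 153, 82, 152, -152, 192, -192],
    [163, -208, 45, -108, 217, 55, -12, 27, -123, -105, 75, 125, -46, -122, 15, -28, -118, 166, -18, -93, 93],
    [-163, 208, -45, 108, -217, -55, 12, -27, 123, 105, -75, -125, 46, 122, -15, 28, 118, 18, -166, 187, -187],
    [-76, 120, -44, -53, 173, 74, 103, -204, 203, 150, -206, 195, -14, 131, 154, -180, -198, 71, -189, -184, -26],
    [76, -120, 44, 53, -173, -74, -103, 204, -203, -150, 206, -195, 14, -131, -154, 180, 198, -71, 189, 26, 184]]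

theorem exists_isASMS_twentyOne : ∃ A : Matrix (Fin 21) (Fin 21) ℤ, IsASMS A :=
  ⟨_, isASMS_of_table (L := table21) (N := 220) (by norm_num) rfl (by decide +kernel)
    (by decide +kernel) (by decide +kernel) (by decide +kernel)⟩

/-- The table of order `13` from which the large squares are grown. -/
def coreTable : List (List ℤ) := [
    [31, -57, -46, 36, -60, 24, 72, 8, -8, -67, 67, 3, -3],
    [-34, 34, -6, -12, 0, 12, 6, 41, -41, -4, 4, 22, -22],
    [78, 65, -65, -24, 60, -36, -78, -49, 49, 71, -71, -25, 25],
    [47, -66, 19, -17, -27, 75, -31, -43, 43, -59, 59, -54, 54],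
    [-72, 57, 15, 79, -53, -7, -19, 39, -39, 73, -73, -37, 37],
    [13, -79, 66, -47, 53, 7, -13, -64, 64, -69, 69, 42, -42],
    [-63, 46, 17, -15, 27, -75, 63, -29, 29, -16, 16, -51, 51],
    [-44, 9, 35, -32, -26, 14, -11, 76, -21, 2, -2, 58, -58],
    [44, -9, -35, 32, 26, -14, 11, 21, -76, 30, -30, -77, 77],
    [50, 33, -83, 62, -80, 68, 20, -5, -28, 1, -38, -56, 56],
    [-50, -33, 83, -62, 80, -68, -20, 5, 28, 38, -1, 81, -81],
    [-18, -52, 70, -23, -45, -40, 48, -61, 74, 55, -82, 84, -10],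
    [18, 52, -70, 23, 45, 40, -48, 61, -74, -55, 82, 10, -84]]

/-! ### The growing construction

The array below extends `coreTable` level by level: level `k` consists of the rows and columns
`2 * k + 13` and `2 * k + 14`. -/

/-- The value among `a, b, c, d` selected by the residue of `k` modulo `4`. -/
def mod4 (k : ℕ) (a b c d : ℤ) : ℤ :=
  if k % 4 = 0 then a else if k % 4 = 1 then b else if k % 4 = 2 then c else d

/-- The sum of the two entries `colEntry M k i` and `rowEntry M k i`. -/
def pairSum (k i : ℕ) : ℤ :=
  if i = 0 then mod4 k (-1) 1 (-1) 1
  else if i = 1 then mod4 k (-1) 1 2 (-2)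
  else if i = 2 then mod4 k 2 (-2) (-1) 1
  else if i = 3 then mod4 k 1 (-1) 1 1
  else if i = 4 then mod4 k 1 (-1) (-1) 1
  else if i = 5 then -2
  else if i = 6 then -2
  else if i = 7 then mod4 k (-1) 1 1 (-1)
  else if i = 8 then mod4 k 1 1 1 (-1)
  else if i < 2 * k + 9 then (if i % 4 = 1 ∨ i % 4 = 2 then 1 else -1)
  else if i < 2 * k + 11 then -(86 + 4 * k)
  else -1

/-- The absolute value of `pairSum`. -/
def pairGap (k i : ℕ) : ℤ :=
  if i = 0 then 1
  else if i = 1 then mod4 k 1 1 2 2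
  else if i = 2 then mod4 k 2 2 1 1
  else if i = 3 then 1
  else if i = 4 then 1
  else if i = 5 then 2
  else if i = 6 then 2
  else if i < 2 * k + 9 then 1
  else if i < 2 * k + 11 then 86 + 4 * k
  else 1

/-- The sign of the difference of `colEntry M k i` and `rowEntry M k i`. -/
def pairSign (k i : ℕ) : ℤ :=
  if i = 0 then mod4 k (-1) 1 (-1) 1
  else if i = 1 then mod4 k 1 (-1) (-1) 1
  else if i = 2 then mod4 k (-1) 1 1 (-1)
  else if i = 3 then mod4 k 1 (-1) 1 (-1)
  else if i = 4 then mod4 k (-1) 1 (-1) 1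
  else if i = 5 then mod4 k (-1) 1 (-1) 1
  else if i = 6 then mod4 k 1 (-1) 1 (-1)
  else if i < 2 * k + 9 then (if i % 4 = 0 ∨ i % 4 = 1 then 1 else -1)
  else if i = 2 * k + 9 then 1
  else if i = 2 * k + 10 then -1
  else if i = 2 * k + 11 then -1
  else 1

/-- The number of blocks of four consecutive magnitudes used by the levels below `k`. -/
def blockCount : ℕ → ℕ
  | 0 => 0
  | k + 1 => blockCount k + (k + 3)

/-- The least magnitude of the `t`-th block of four consecutive magnitudes. -/
def blockLow (M t : ℕ) : ℤ :=
  if t < 63 then (85 + 4 * M : ℤ) + (t / 21 : ℕ) * (4 * M + 84) + 2 * M + 4 * (t % 21 : ℕ)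
  else (85 + 4 * M : ℤ) + 3 * (4 * M + 84) + 4 * ((t : ℤ) - 63)

/-- The smaller one of the magnitudes of `colEntry M k i` and `rowEntry M k i`. -/
def pairLow (M k i : ℕ) : ℤ :=
  if i = 0 then (85 + 4 * M : ℤ) + 2 * (M - 1 - k)
  else if i = 1 then
    (if k % 4 < 2 then (85 + 4 * M : ℤ) + (2 * M + 84 + 2 * k) else 85 + 4 * k)
  else if i = 2 then
    (if k % 4 < 2 then (85 + 4 * k : ℤ) else (85 + 4 * M : ℤ) + (2 * M + 84 + 2 * k))
  else if i < 2 * k + 9 then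
    blockLow M (blockCount k + (i - 3) / 2) + (if i % 2 = 1 then 0 else if i = 6 then 1 else 2)
  else if i = 2 * k + 9 then (85 + 4 * M : ℤ) + (4 * M + 84) + 2 * (M - 1 - k)
  else if i = 2 * k + 10 then (85 + 4 * M : ℤ) + (4 * M + 84) + 2 * (M - 1 - k) + 1
  else if i = 2 * k + 11 then (85 + 4 * M : ℤ) + 2 * (4 * M + 84) + 2 * (M - 1 - k)
  else (85 + 4 * M : ℤ) + 2 * (4 * M + 84) + (2 * M + 84 + 2 * k)

/-- The difference of the two entries `colEntry M k i` and `rowEntry M k i`. -/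
def pairDiff (M k i : ℕ) : ℤ := pairSign k i * (2 * pairLow M k i + pairGap k i)

/-- The entry in row `i` and column `2 * k + 13`, for `i < 2 * k + 13`. -/
def colEntry (M k i : ℕ) : ℤ := (pairSum k i + pairDiff M k i) / 2

/-- The entry in row `2 * k + 13` and column `i`, for `i < 2 * k + 13`. -/
def rowEntry (M k i : ℕ) : ℤ := (pairSum k i - pairDiff M k i) / 2

/-! ### Arithmetic of a single pair of entries -/

theorem mod4_sign {k : ℕ} {a b c d : ℤ} (ha : a = 1 ∨ a = -1) (hb : b = 1 ∨ b = -1)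
    (hc : c = 1 ∨ c = -1) (hd : d = 1 ∨ d = -1) : mod4 k a b c d = 1 ∨ mod4 k a b c d = -1 := by
  unfold mod4; split_ifs <;> assumption

theorem ite_sign {p : Prop} [Decidable p] {a b : ℤ} (ha : a = 1 ∨ a = -1)
    (hb : b = 1 ∨ b = -1) : (if p then a else b) = 1 ∨ (if p then a else b) = -1 := by
  split_ifs <;> assumption

theorem pairSign_eq (k i : ℕ) : pairSign k i = 1 ∨ pairSign k i = -1 := by
  have h1 : (1 : ℤ) = 1 ∨ (1 : ℤ) = -1 := Or.inl rfl
  have h2 : (-1 : ℤ) = 1 ∨ (-1 : ℤ) = -1 := Or.inr rfl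
  unfold pairSign
  repeat' first | assumption | apply mod4_sign | apply ite_sign

/-- Gives `pairSum` and `pairDiff` the same parity, so that the halvings in `colEntry` and
`rowEntry` are exact. -/
theorem pairSum_eq (k i : ℕ) : pairSum k i = pairGap k i ∨ pairSum k i = -pairGap k i := by
  by_cases h0 : i = 0
  · simp only [pairSum, pairGap, mod4, h0]; simp only [if_true]; split_ifs <;> simp
  by_cases h1 : i = 1
  · simp only [pairSum, pairGap, mod4, h1]; norm_num; split_ifs <;> simp
  by_cases h2 : i = 2
  · simp only [pairSum, pairGap, mod4, h2]; norm_num; split_ifs <;> simp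
  by_cases h7 : i = 7
  · simp only [pairSum, pairGap, mod4, h7]; norm_num; split_ifs <;> omega
  by_cases h8 : i = 8
  · simp only [pairSum, pairGap, mod4, h8]; norm_num; split_ifs <;> omega
  simp only [pairSum, pairGap, mod4, h0, h1, h2, h7, h8, if_false]
  split_ifs <;> omega

theorem two_mul_colEntry (M k i : ℕ) : 2 * colEntry M k i = pairSum k i + pairDiff M k i := by
  unfold colEntry pairDiff
  rcases pairSign_eq k i with h | h <;> rcases pairSum_eq k i with h' | h' <;> rw [h, h'] <;> omega

theorem two_mul_rowEntry (M k i : ℕ) : 2 * rowEntry M k i = pairSum k i - pairDiff M k i := by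
  unfold rowEntry pairDiff
  rcases pairSign_eq k i with h | h <;> rcases pairSum_eq k i with h' | h' <;> rw [h, h'] <;> omega

theorem colEntry_add_rowEntry (M k i : ℕ) : colEntry M k i + rowEntry M k i = pairSum k i := by
  have := two_mul_colEntry M k i
  have := two_mul_rowEntry M k i
  omega

/-- Up to sign, the two entries of a pair are `pairLow` and `pairLow + pairGap`. -/
theorem pair_magnitudes (M k i : ℕ) :
    ((colEntry M k i = pairLow M k i ∨ colEntry M k i = -pairLow M k i) ∧
      (rowEntry M k i = pairLow M k i + pairGap k i ∨
        rowEntry M k i = -(pairLow M k i + pairGap k i))) ∨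
    ((rowEntry M k i = pairLow M k i ∨ rowEntry M k i = -pairLow M k i) ∧
      (colEntry M k i = pairLow M k i + pairGap k i ∨
        colEntry M k i = -(pairLow M k i + pairGap k i))) := by
  unfold colEntry rowEntry pairDiff
  rcases pairSign_eq k i with h | h <;> rcases pairSum_eq k i with h' | h' <;> rw [h, h'] <;> omega

/-- The infinite array whose leading block of order `2 * M + 13` is an ASMS for `10 ≤ M`. -/
def grownArray (M i j : ℕ) : ℤ :=
  if i < 13 ∧ j < 13 then tableArray coreTable i j
  else if 13 ≤ j ∧ i < 2 * ((j - 13) / 2) + 13 then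
    (if j % 2 = 1 then colEntry M ((j - 13) / 2) i else -colEntry M ((j - 13) / 2) i)
  else if 13 ≤ i ∧ j < 2 * ((i - 13) / 2) + 13 then
    (if i % 2 = 1 then rowEntry M ((i - 13) / 2) j else -rowEntry M ((i - 13) / 2) j)
  else if i % 2 = 1 then
    (if j % 2 = 1 then 88 + 4 * ((i - 13) / 2 : ℕ) else 86 + 4 * ((i - 13) / 2 : ℕ))
  else
    (if j % 2 = 1 then -(86 + 4 * ((i - 13) / 2 : ℕ)) else -(88 + 4 * ((i - 13) / 2 : ℕ)))

/-! ### Reading off the entries of the array -/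

theorem grownArray_core {M i j : ℕ} (hi : i < 13) (hj : j < 13) :
    grownArray M i j = tableArray coreTable i j := by
  simp [grownArray, hi, hj]

section entries

variable {M k i : ℕ}

theorem grownArray_col_odd (h : i < 2 * k + 13) :
    grownArray M i (2 * k + 13) = colEntry M k i := by
  have h1 : (2 * k + 13 - 13) / 2 = k := by omega
  have h2 : (2 * k + 13) % 2 = 1 := by omega
  have h3 : ¬ (i < 13 ∧ 2 * k + 13 < 13) := by omega
  have h4 : 13 ≤ 2 * k + 13 ∧ i < 2 * k + 13 := by omega
  simp only [grownArray, h1, h2, h3, if_false, if_true]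
  rw [if_pos h4]

theorem grownArray_col_even (h : i < 2 * k + 13) :
    grownArray M i (2 * k + 14) = -colEntry M k i := by
  have h1 : (2 * k + 14 - 13) / 2 = k := by omega
  have h2 : ¬ (2 * k + 14) % 2 = 1 := by omega
  have h3 : ¬ (i < 13 ∧ 2 * k + 14 < 13) := by omega
  have h4 : 13 ≤ 2 * k + 14 ∧ i < 2 * k + 13 := by omega
  simp only [grownArray, h1, h2, h3, if_false]
  rw [if_pos h4]

theorem grownArray_row_odd (h : i < 2 * k + 13) :
    grownArray M (2 * k + 13) i = rowEntry M k i := by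
  have h1 : (2 * k + 13 - 13) / 2 = k := by omega
  have h2 : (2 * k + 13) % 2 = 1 := by omega
  have h3 : ¬ (2 * k + 13 < 13 ∧ i < 13) := by omega
  have h4 : 13 ≤ 2 * k + 13 ∧ i < 2 * k + 13 := by omega
  have h5 : ¬ (13 ≤ i ∧ 2 * k + 13 < 2 * ((i - 13) / 2) + 13) := by omega
  simp only [grownArray, h1, h2, h3, h5, if_false, if_true]
  rw [if_pos h4]

theorem grownArray_row_even (h : i < 2 * k + 13) :
    grownArray M (2 * k + 14) i = -rowEntry M k i := by
  have h1 : (2 * k + 14 - 13) / 2 = k := by omega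
  have h2 : ¬ (2 * k + 14) % 2 = 1 := by omega
  have h3 : ¬ (2 * k + 14 < 13 ∧ i < 13) := by omega
  have h4 : 13 ≤ 2 * k + 14 ∧ i < 2 * k + 13 := by omega
  have h5 : ¬ (13 ≤ i ∧ 2 * k + 14 < 2 * ((i - 13) / 2) + 13) := by omega
  simp only [grownArray, h1, h2, h3, h5, if_false]
  rw [if_pos h4]

theorem grownArray_diag_odd_odd : grownArray M (2 * k + 13) (2 * k + 13) = 88 + 4 * k := by
  have h1 : (2 * k + 13 - 13) / 2 = k := by omega
  have h2 : (2 * k + 13) % 2 = 1 := by omega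
  have h3 : ¬ (2 * k + 13 < 13 ∧ 2 * k + 13 < 13) := by omega
  have h4 : ¬ (13 ≤ 2 * k + 13 ∧ 2 * k + 13 < 2 * k + 13) := by omega
  simp only [grownArray, h1, h2, h3, h4, if_false, if_true]

theorem grownArray_diag_odd_even : grownArray M (2 * k + 13) (2 * k + 14) = 86 + 4 * k := by
  have h1 : (2 * k + 13 - 13) / 2 = k := by omega
  have h1' : (2 * k + 14 - 13) / 2 = k := by omega
  have h2 : (2 * k + 13) % 2 = 1 := by omega
  have h2' : ¬ (2 * k + 14) % 2 = 1 := by omega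
  have h3 : ¬ (2 * k + 13 < 13 ∧ 2 * k + 14 < 13) := by omega
  have h4 : ¬ (13 ≤ 2 * k + 14 ∧ 2 * k + 13 < 2 * k + 13) := by omega
  have h5 : ¬ (13 ≤ 2 * k + 13 ∧ 2 * k + 14 < 2 * k + 13) := by omega
  simp only [grownArray, h1, h1', h2, h2', h3, h4, h5, if_false, if_true]

theorem grownArray_diag_even_odd : grownArray M (2 * k + 14) (2 * k + 13) = -(86 + 4 * k) := by
  have h1 : (2 * k + 14 - 13) / 2 = k := by omega
  have h1' : (2 * k + 13 - 13) / 2 = k := by omega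
  have h2 : ¬ (2 * k + 14) % 2 = 1 := by omega
  have h2' : (2 * k + 13) % 2 = 1 := by omega
  have h3 : ¬ (2 * k + 14 < 13 ∧ 2 * k + 13 < 13) := by omega
  have h4 : ¬ (13 ≤ 2 * k + 13 ∧ 2 * k + 14 < 2 * k + 13) := by omega
  have h5 : ¬ (13 ≤ 2 * k + 14 ∧ 2 * k + 13 < 2 * k + 13) := by omega
  simp only [grownArray, h1, h1', h2, h2', h3, h4, h5, if_false, if_true]

theorem grownArray_diag_even_even : grownArray M (2 * k + 14) (2 * k + 14) = -(88 + 4 * k) := by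
  have h1 : (2 * k + 14 - 13) / 2 = k := by omega
  have h2 : ¬ (2 * k + 14) % 2 = 1 := by omega
  have h3 : ¬ (2 * k + 14 < 13 ∧ 2 * k + 14 < 13) := by omega
  have h4 : ¬ (13 ≤ 2 * k + 14 ∧ 2 * k + 14 < 2 * k + 13) := by omega
  simp only [grownArray, h1, h2, h3, h4, if_false]

end entries

/-! ### Row, column and main diagonal sums -/

section sums

open Finset

theorem sum_range_add_three (F : ℕ → ℤ) (n : ℕ) :
    ∑ i ∈ range (n + 3), F i = F 0 + F 1 + F 2 + ∑ i ∈ range n, F (3 + i) := by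
  rw [add_comm n 3, sum_range_add]
  simp [sum_range_succ]

theorem sum_range_two_mul (F : ℕ → ℤ) (n : ℕ) :
    ∑ i ∈ range (2 * n), F i = ∑ t ∈ range n, (F (2 * t) + F (2 * t + 1)) := by
  induction n with
  | zero => simp
  | succ n ih => rw [mul_add, mul_one, sum_range_succ, sum_range_succ, ih, sum_range_succ]; ring

theorem sum_range_alternate (n : ℕ) (c : ℤ) :
    ∑ t ∈ range n, (if t % 2 = 0 then c else -c) = if n % 2 = 0 then 0 else c := by
  induction n with
  | zero => simp
  | succ n ih => rw [sum_range_succ, ih]; split_ifs <;> omega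

/-- Splitting of the sum over the rows above a level. -/
theorem sum_range_level (F : ℕ → ℤ) (k : ℕ) :
    ∑ i ∈ range (2 * k + 13), F i =
      ∑ i ∈ range 9, F i + ∑ t ∈ range k, (F (9 + 2 * t) + F (9 + (2 * t + 1))) +
        (F (2 * k + 9) + F (2 * k + 10) + F (2 * k + 11) + F (2 * k + 12)) := by
  rw [sum_range_succ, sum_range_succ, sum_range_succ, sum_range_succ,
    add_comm (2 * k) 9, sum_range_add, sum_range_two_mul]
  ring_nf

theorem mod4_of_zero {k : ℕ} (h : k % 4 = 0) (a b c d : ℤ) : mod4 k a b c d = a := by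
  simp [mod4, h]

theorem mod4_of_one {k : ℕ} (h : k % 4 = 1) (a b c d : ℤ) : mod4 k a b c d = b := by
  simp [mod4, h]

theorem mod4_of_two {k : ℕ} (h : k % 4 = 2) (a b c d : ℤ) : mod4 k a b c d = c := by
  simp [mod4, h]

theorem mod4_of_three {k : ℕ} (h : k % 4 = 3) (a b c d : ℤ) : mod4 k a b c d = d := by
  simp [mod4, h]

theorem pairSum_generic {k i : ℕ} (h : 9 ≤ i) (h' : i < 2 * k + 9) :
    pairSum k i = if i % 4 = 1 ∨ i % 4 = 2 then 1 else -1 := by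
  unfold pairSum
  iterate 9 rw [if_neg (by omega)]
  rw [if_pos h']

theorem pairSum_large {k i : ℕ} (h : 2 * k + 9 ≤ i) (h' : i < 2 * k + 11) :
    pairSum k i = -(86 + 4 * k) := by
  unfold pairSum
  iterate 10 rw [if_neg (by omega)]
  rw [if_pos h']

theorem pairSum_last {k i : ℕ} (h : 2 * k + 11 ≤ i) : pairSum k i = -1 := by
  unfold pairSum
  iterate 11 rw [if_neg (by omega)]

theorem pairSum_triple (k : ℕ) : pairSum k 0 + pairSum k 1 + pairSum k 2 = 0 := by
  simp only [pairSum, mod4]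
  norm_num
  split_ifs <;> norm_num

/-- The generic entries, taken in twos, alternate between 2 and -2; what is left depends on the
parity of `k`, and the nine irregular entries bring it to -2. The other four entries give -(172 +
8k) and -2. -/
theorem sum_pairSum (k : ℕ) : ∑ i ∈ range (2 * k + 13), pairSum k i = -(176 + 8 * k) := by
  rw [sum_range_level, pairSum_large (by omega) (by omega), pairSum_large (by omega) (by omega),
    pairSum_last (by omega), pairSum_last (by omega)]
  have h : ∑ t ∈ range k, (pairSum k (9 + 2 * t) + pairSum k (9 + (2 * t + 1))) =
      ∑ t ∈ range k, (if t % 2 = 0 then 2 else -2) := by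
    refine sum_congr rfl fun t ht => ?_
    have := mem_range.1 ht
    rw [pairSum_generic (by omega) (by omega), pairSum_generic (by omega) (by omega)]
    split_ifs <;> omega
  rw [h, sum_range_alternate]
  have h4 : k % 4 = 0 ∨ k % 4 = 1 ∨ k % 4 = 2 ∨ k % 4 = 3 := by omega
  rcases h4 with h4 | h4 | h4 | h4
  · rw [if_pos (by omega)]; simp [sum_range_succ, pairSum, mod4_of_zero h4]; ring
  · rw [if_neg (by omega)]; simp [sum_range_succ, pairSum, mod4_of_one h4]; ring
  · rw [if_pos (by omega)]; simp [sum_range_succ, pairSum, mod4_of_two h4]; ring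
  · rw [if_neg (by omega)]; simp [sum_range_succ, pairSum, mod4_of_three h4]; ring

/-- The two indices share a block of four and carry opposite signs, so the base of the block cancels
and only ±4 remains. -/
theorem pairDiff_generic {M k t : ℕ} (h : t < k) :
    pairDiff M k (9 + 2 * t) + pairDiff M k (9 + (2 * t + 1)) = if t % 2 = 0 then -4 else -(-4) := by
  have hg : ∀ i, 9 ≤ i → i < 2 * k + 9 → pairGap k i = 1 := by
    intro i h1 h2
    unfold pairGap
    iterate 7 rw [if_neg (by omega)]
    rw [if_pos h2]
  have hs : ∀ i, 9 ≤ i → i < 2 * k + 9 →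
      pairSign k i = if i % 4 = 0 ∨ i % 4 = 1 then 1 else -1 := by
    intro i h1 h2
    unfold pairSign
    iterate 7 rw [if_neg (by omega)]
    rw [if_pos h2]
  have hl : ∀ i, 9 ≤ i → i < 2 * k + 9 → pairLow M k i =
      blockLow M (blockCount k + (i - 3) / 2) + (if i % 2 = 1 then 0 else if i = 6 then 1 else 2) := by
    intro i h1 h2
    unfold pairLow
    iterate 3 rw [if_neg (by omega)]
    rw [if_pos h2]
  unfold pairDiff
  rw [hg _ (by omega) (by omega), hg _ (by omega) (by omega), hs _ (by omega) (by omega),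
    hs _ (by omega) (by omega), hl _ (by omega) (by omega), hl _ (by omega) (by omega),
    show (9 + 2 * t - 3) / 2 = t + 3 by omega, show (9 + (2 * t + 1) - 3) / 2 = t + 3 by omega,
    if_pos (show (9 + 2 * t) % 2 = 1 by omega), if_neg (show ¬ (9 + (2 * t + 1)) % 2 = 1 by omega),
    if_neg (show ¬ 9 + (2 * t + 1) = 6 by omega)]
  generalize blockLow M (blockCount k + (t + 3)) = x
  split_ifs <;> omega

/-- The magnitudes at index 0 fall by 2 per level, those next to the core rise by 4 and the high
ones rise by 2; hence the first two can add up to the third at every level. -/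
theorem pairDiff_triple (M k : ℕ) : pairDiff M k 0 + pairDiff M k 1 + pairDiff M k 2 = 0 := by
  have h4 : k % 4 = 0 ∨ k % 4 = 1 ∨ k % 4 = 2 ∨ k % 4 = 3 := by omega
  rcases h4 with h4 | h4 | h4 | h4
  · have : k % 4 < 2 := by omega
    simp [pairDiff, pairSign, pairLow, pairGap, mod4_of_zero h4, this]; ring
  · have : k % 4 < 2 := by omega
    simp [pairDiff, pairSign, pairLow, pairGap, mod4_of_one h4, this]; ring
  · have : ¬ k % 4 < 2 := by omega
    simp [pairDiff, pairSign, pairLow, pairGap, mod4_of_two h4, this]; ring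
  · have : ¬ k % 4 < 2 := by omega
    simp [pairDiff, pairSign, pairLow, pairGap, mod4_of_three h4, this]; ring

theorem pairDiff_blocks (M k : ℕ) :
    pairDiff M k 3 + pairDiff M k 4 + pairDiff M k 5 + pairDiff M k 6 + pairDiff M k 7 +
      pairDiff M k 8 = if k % 2 = 0 then 2 else 6 := by
  have h (i : ℕ) (h3 : 3 ≤ i) (h8 : i < 2 * k + 9) : pairLow M k i =
      blockLow M (blockCount k + (i - 3) / 2) +
        (if i % 2 = 1 then 0 else if i = 6 then 1 else 2) := by
    unfold pairLow
    iterate 3 rw [if_neg (by omega)]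
    rw [if_pos h8]
  have h7 : 7 < 2 * k + 9 := by omega
  have h8 : 8 < 2 * k + 9 := by omega
  unfold pairDiff
  rw [h 3 (by omega) (by omega), h 4 (by omega) (by omega), h 5 (by omega) (by omega),
    h 6 (by omega) (by omega), h 7 (by omega) (by omega), h 8 (by omega) (by omega)]
  have h4 : k % 4 = 0 ∨ k % 4 = 1 ∨ k % 4 = 2 ∨ k % 4 = 3 := by omega
  rcases h4 with h4 | h4 | h4 | h4
  · have hk : k % 2 = 0 := by omega
    simp [pairSign, pairGap, mod4_of_zero h4, h7, h8, hk]; ring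
  · have hk : k % 2 = 1 := by omega
    simp [pairSign, pairGap, mod4_of_one h4, h7, h8, hk]; ring
  · have hk : k % 2 = 0 := by omega
    simp [pairSign, pairGap, mod4_of_two h4, h7, h8, hk]; ring
  · have hk : k % 2 = 1 := by omega
    simp [pairSign, pairGap, mod4_of_three h4, h7, h8, hk]; ring

theorem pairDiff_large_fst (M k : ℕ) : pairDiff M k (2 * k + 9) =
    2 * ((85 + 4 * M : ℤ) + (4 * M + 84) + 2 * (M - 1 - k)) + (86 + 4 * k) := by
  unfold pairDiff
  have h1 : pairSign k (2 * k + 9) = 1 := by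
    unfold pairSign
    iterate 8 rw [if_neg (by omega)]
    rw [if_pos rfl]
  have h2 : pairGap k (2 * k + 9) = 86 + 4 * k := by
    unfold pairGap
    iterate 8 rw [if_neg (by omega)]
    rw [if_pos (by omega)]
  have h3 : pairLow M k (2 * k + 9) =
      (85 + 4 * M : ℤ) + (4 * M + 84) + 2 * (M - 1 - k) := by
    unfold pairLow
    iterate 4 rw [if_neg (by omega)]
    rw [if_pos rfl]
  rw [h1, h2, h3]; ring

theorem pairDiff_large_snd (M k : ℕ) : pairDiff M k (2 * k + 10) =
    -(2 * ((85 + 4 * M : ℤ) + (4 * M + 84) + 2 * (M - 1 - k) + 1) + (86 + 4 * k)) := by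
  unfold pairDiff
  have h1 : pairSign k (2 * k + 10) = -1 := by
    unfold pairSign
    iterate 9 rw [if_neg (by omega)]
    rw [if_pos rfl]
  have h2 : pairGap k (2 * k + 10) = 86 + 4 * k := by
    unfold pairGap
    iterate 8 rw [if_neg (by omega)]
    rw [if_pos (by omega)]
  have h3 : pairLow M k (2 * k + 10) =
      (85 + 4 * M : ℤ) + (4 * M + 84) + 2 * (M - 1 - k) + 1 := by
    unfold pairLow
    iterate 5 rw [if_neg (by omega)]
    rw [if_pos rfl]
  rw [h1, h2, h3]; ring

theorem pairDiff_last_fst (M k : ℕ) : pairDiff M k (2 * k + 11) =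
    -(2 * ((85 + 4 * M : ℤ) + 2 * (4 * M + 84) + 2 * (M - 1 - k)) + 1) := by
  unfold pairDiff
  have h1 : pairSign k (2 * k + 11) = -1 := by
    unfold pairSign
    iterate 10 rw [if_neg (by omega)]
    rw [if_pos rfl]
  have h2 : pairGap k (2 * k + 11) = 1 := by
    unfold pairGap
    iterate 9 rw [if_neg (by omega)]
  have h3 : pairLow M k (2 * k + 11) =
      (85 + 4 * M : ℤ) + 2 * (4 * M + 84) + 2 * (M - 1 - k) := by
    unfold pairLow
    iterate 6 rw [if_neg (by omega)]
    rw [if_pos rfl]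
  rw [h1, h2, h3]; ring

theorem pairDiff_last_snd (M k : ℕ) : pairDiff M k (2 * k + 12) =
    2 * ((85 + 4 * M : ℤ) + 2 * (4 * M + 84) + (2 * M + 84 + 2 * k)) + 1 := by
  unfold pairDiff
  have h1 : pairSign k (2 * k + 12) = 1 := by
    unfold pairSign
    iterate 11 rw [if_neg (by omega)]
  have h2 : pairGap k (2 * k + 12) = 1 := by
    unfold pairGap
    iterate 9 rw [if_neg (by omega)]
  have h3 : pairLow M k (2 * k + 12) =
      (85 + 4 * M : ℤ) + 2 * (4 * M + 84) + (2 * M + 84 + 2 * k) := by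
    unfold pairLow
    iterate 7 rw [if_neg (by omega)]
  rw [h1, h2, h3]; ring

theorem pairDiff_tail (M k : ℕ) :
    pairDiff M k (2 * k + 9) + pairDiff M k (2 * k + 10) + pairDiff M k (2 * k + 11) +
      pairDiff M k (2 * k + 12) = 170 + 8 * k := by
  rw [pairDiff_large_fst, pairDiff_large_snd, pairDiff_last_fst, pairDiff_last_snd]
  ring

theorem sum_pairDiff (M k : ℕ) : ∑ i ∈ range (2 * k + 13), pairDiff M k i = 172 + 8 * k := by
  rw [sum_range_level, pairDiff_tail, sum_congr rfl fun t ht => pairDiff_generic (mem_range.1 ht),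
    sum_range_alternate]
  have h1 := pairDiff_triple M k
  have h2 := pairDiff_blocks M k
  simp only [sum_range_succ, range_zero, sum_empty]
  split_ifs at h2 ⊢ <;> omega

/-- The value -2 balances the corner contribution (88 + 4k) - (86 + 4k) to the column. -/
theorem sum_colEntry (M k : ℕ) : ∑ i ∈ range (2 * k + 13), colEntry M k i = -2 := by
  have h : 2 * ∑ i ∈ range (2 * k + 13), colEntry M k i =
      ∑ i ∈ range (2 * k + 13), pairSum k i + ∑ i ∈ range (2 * k + 13), pairDiff M k i := by
    rw [mul_sum, ← sum_add_distrib]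
    exact sum_congr rfl fun i _ => two_mul_colEntry M k i
  rw [sum_pairSum, sum_pairDiff] at h
  omega

/-- Balances the corner contribution (88 + 4k) + (86 + 4k) to the row. -/
theorem sum_rowEntry (M k : ℕ) :
    ∑ i ∈ range (2 * k + 13), rowEntry M k i = -(174 + 8 * k) := by
  have h : 2 * ∑ i ∈ range (2 * k + 13), rowEntry M k i =
      ∑ i ∈ range (2 * k + 13), pairSum k i - ∑ i ∈ range (2 * k + 13), pairDiff M k i := by
    rw [mul_sum, ← sum_sub_distrib]
    exact sum_congr rfl fun i _ => two_mul_rowEntry M k i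
  rw [sum_pairSum, sum_pairDiff] at h
  omega

theorem colEntry_triple (M k : ℕ) : colEntry M k 0 + colEntry M k 1 + colEntry M k 2 = 0 := by
  have := pairSum_triple k
  have := pairDiff_triple M k
  have := two_mul_colEntry M k 0
  have := two_mul_colEntry M k 1
  have := two_mul_colEntry M k 2
  omega

theorem rowEntry_triple (M k : ℕ) : rowEntry M k 0 + rowEntry M k 1 + rowEntry M k 2 = 0 := by
  have := pairSum_triple k
  have := pairDiff_triple M k
  have := two_mul_rowEntry M k 0
  have := two_mul_rowEntry M k 1
  have := two_mul_rowEntry M k 2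
  omega

variable (M : ℕ)

theorem sum_row_grownArray (k : ℕ) :
    ∀ i < 2 * k + 13, ∑ j ∈ range (2 * k + 13), grownArray M i j = 0 := by
  induction k with
  | zero =>
    intro i hi
    rw [sum_congr rfl fun j hj => grownArray_core hi (mem_range.1 hj)]
    revert i
    decide
  | succ k ih =>
    intro i hi
    rw [show 2 * (k + 1) + 13 = 2 * k + 13 + 1 + 1 by ring, sum_range_succ, sum_range_succ]
    obtain h | h | h : i < 2 * k + 13 ∨ i = 2 * k + 13 ∨ i = 2 * k + 14 := by omega
    -- An old row meets the two new columns in opposite entries.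
    · rw [ih i h, grownArray_col_odd h, grownArray_col_even h]; ring
    · subst h
      rw [sum_congr rfl fun j hj => grownArray_row_odd (mem_range.1 hj), sum_rowEntry,
        grownArray_diag_odd_odd, grownArray_diag_odd_even]
      ring
    · subst h
      rw [sum_congr rfl fun j hj => grownArray_row_even (mem_range.1 hj), sum_neg_distrib,
        sum_rowEntry, grownArray_diag_even_odd, grownArray_diag_even_even]
      ring

theorem sum_col_grownArray (k : ℕ) :
    ∀ j < 2 * k + 13, ∑ i ∈ range (2 * k + 13), grownArray M i j = 0 := by
  induction k with
  | zero =>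
    intro j hj
    rw [sum_congr rfl fun i hi => grownArray_core (mem_range.1 hi) hj]
    revert j
    decide
  | succ k ih =>
    intro j hj
    rw [show 2 * (k + 1) + 13 = 2 * k + 13 + 1 + 1 by ring, sum_range_succ, sum_range_succ]
    obtain h | h | h : j < 2 * k + 13 ∨ j = 2 * k + 13 ∨ j = 2 * k + 14 := by omega
    · rw [ih j h, grownArray_row_odd h, grownArray_row_even h]; ring
    · subst h
      rw [sum_congr rfl fun i hi => grownArray_col_odd (mem_range.1 hi), sum_colEntry,
        grownArray_diag_odd_odd, grownArray_diag_even_odd]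
      ring
    · subst h
      rw [sum_congr rfl fun i hi => grownArray_col_even (mem_range.1 hi), sum_neg_distrib,
        sum_colEntry, grownArray_diag_odd_even, grownArray_diag_even_even]
      ring

theorem sum_diag_grownArray (k : ℕ) : ∑ i ∈ range (2 * k + 13), grownArray M i i = 0 := by
  induction k with
  | zero =>
    rw [sum_congr rfl fun i hi => grownArray_core (mem_range.1 hi) (mem_range.1 hi)]
    decide
  | succ k ih =>
    rw [show 2 * (k + 1) + 13 = 2 * k + 13 + 1 + 1 by ring, sum_range_succ, sum_range_succ, ih,
      grownArray_diag_odd_odd, grownArray_diag_even_even]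
    ring

/-! ### Zero triples in the first three rows and columns -/

theorem exists_level {i : ℕ} (h : 13 ≤ i) : ∃ k, i = 2 * k + 13 ∨ i = 2 * k + 14 :=
  ⟨(i - 13) / 2, by omega⟩

theorem grownArray_row_triple {i : ℕ} (hi : 3 ≤ i) :
    grownArray M i 0 + grownArray M i 1 + grownArray M i 2 = 0 := by
  obtain h | h := lt_or_ge i 13
  · rw [grownArray_core h (by omega), grownArray_core h (by omega), grownArray_core h (by omega)]
    revert i
    decide
  · have := rowEntry_triple M
    obtain ⟨k, rfl | rfl⟩ := exists_level h
    · rw [grownArray_row_odd (by omega), grownArray_row_odd (by omega),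
        grownArray_row_odd (by omega), this]
    · rw [grownArray_row_even (by omega), grownArray_row_even (by omega),
        grownArray_row_even (by omega)]
      have := this k
      omega

theorem grownArray_col_triple {j : ℕ} (hj : 3 ≤ j) :
    grownArray M 0 j + grownArray M 1 j + grownArray M 2 j = 0 := by
  obtain h | h := lt_or_ge j 13
  · rw [grownArray_core (by omega) h, grownArray_core (by omega) h, grownArray_core (by omega) h]
    revert j
    decide
  · have := colEntry_triple M
    obtain ⟨k, rfl | rfl⟩ := exists_level h
    · rw [grownArray_col_odd (by omega), grownArray_col_odd (by omega),
        grownArray_col_odd (by omega), this]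
    · rw [grownArray_col_even (by omega), grownArray_col_even (by omega),
        grownArray_col_even (by omega)]
      have := this k
      omega

theorem grownArray_diag_triple :
    grownArray M 0 0 + grownArray M 1 1 + grownArray M 2 2 = 0 := by
  simp only [grownArray_core (show 0 < 13 by norm_num) (show 0 < 13 by norm_num),
    grownArray_core (show 1 < 13 by norm_num) (show 1 < 13 by norm_num),
    grownArray_core (show 2 < 13 by norm_num) (show 2 < 13 by norm_num)]
  decide

end sums

/-! ### Back diagonals -/

section backDiagonals

open Finset

theorem sum_range_fold_odd (h : ℕ → ℤ) (n : ℕ) :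
    ∑ i ∈ range (2 * n + 1), h i = ∑ i ∈ range n, (h i + h (2 * n - i)) + h n := by
  rw [show 2 * n + 1 = n + 1 + n by ring, sum_range_add, sum_range_succ, sum_add_distrib,
    ← sum_range_reflect (fun i => h (n + 1 + i)),
    sum_congr rfl fun i hi => show h (n + 1 + (n - 1 - i)) = h (2 * n - i) by
      congr 1; have := mem_range.1 hi; omega]
  ring

theorem sum_range_fold_even (h : ℕ → ℤ) (n : ℕ) :
    ∑ i ∈ range (2 * n), h i = ∑ i ∈ range n, (h i + h (2 * n - 1 - i)) := by
  rw [show 2 * n = n + n by ring, sum_range_add, sum_add_distrib,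
    ← sum_range_reflect (fun i => h (n + i)),
    sum_congr rfl fun i hi => show h (n + (n - 1 - i)) = h (n + n - 1 - i) by
      congr 1; have := mem_range.1 hi; omega]

/-- The sum of the entries of `grownArray` in the positions `(i, j)` and `(j, i)`, for `i < j`. -/
def symEntry (i j : ℕ) : ℤ :=
  if j < 13 then tableArray coreTable i j + tableArray coreTable j i
  else if i < 2 * ((j - 13) / 2) + 13 then
    (if j % 2 = 1 then pairSum ((j - 13) / 2) i else -pairSum ((j - 13) / 2) i)
  else 0

theorem symEntry_odd {k i : ℕ} (h : i < 2 * k + 13) : symEntry i (2 * k + 13) = pairSum k i := by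
  unfold symEntry
  rw [if_neg (by omega), show (2 * k + 13 - 13) / 2 = k by omega, if_pos h, if_pos (by omega)]

theorem symEntry_even {k i : ℕ} (h : i < 2 * k + 13) : symEntry i (2 * k + 14) = -pairSum k i := by
  unfold symEntry
  rw [if_neg (by omega), show (2 * k + 14 - 13) / 2 = k by omega, if_pos h, if_neg (by omega)]

theorem symEntry_odd_even (k : ℕ) : symEntry (2 * k + 13) (2 * k + 14) = 0 := by
  unfold symEntry
  rw [if_neg (by omega), if_neg (by omega)]

/-- Here `M` disappears: the chosen magnitudes do not affect sums of transposed pairs, so back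
diagonals can be treated for all `M` at once. -/
theorem grownArray_add_swap (M : ℕ) {i j : ℕ} (h : i < j) :
    grownArray M i j + grownArray M j i = symEntry i j := by
  obtain hj | hj := lt_or_ge j 13
  · rw [grownArray_core (by omega) hj, grownArray_core hj (by omega), symEntry, if_pos hj]
  · obtain ⟨k, rfl | rfl⟩ := exists_level hj
    · rw [grownArray_col_odd h, grownArray_row_odd h, symEntry_odd h, colEntry_add_rowEntry]
    · obtain h' | rfl : i < 2 * k + 13 ∨ i = 2 * k + 13 := by omega
      · rw [grownArray_col_even h', grownArray_row_even h', symEntry_even h',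
          ← colEntry_add_rowEntry M]
        ring
      · rw [grownArray_diag_odd_even, grownArray_diag_even_odd, symEntry_odd_even]
        ring

theorem pairSum_alternate {k t : ℕ} (h : 2 * t + 11 < 2 * k + 9) :
    pairSum k (2 * (5 + t) + 1) - pairSum k (2 * (5 + t)) = if t % 2 = 0 then -2 else -(-2) := by
  rw [pairSum_generic (by omega) (by omega), pairSum_generic (by omega) (by omega)]
  split_ifs <;> omega

/-- The part of the back diagonal sum that comes from the first ten rows. -/
theorem sum_first_rows {k : ℕ} (h : 7 ≤ k) :
    ∑ t ∈ range 5, (pairSum (k - 1 - t) (2 * t + 1) - pairSum (k - 1 - t) (2 * t)) =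
      mod4 k 1 2 (-1) 2 := by
  have e4 : pairSum (k - 1 - 4) 9 = 1 := by
    rw [pairSum_generic (by omega) (by omega)]; rfl
  have h4 : k % 4 = 0 ∨ k % 4 = 1 ∨ k % 4 = 2 ∨ k % 4 = 3 := by omega
  simp only [sum_range_succ, range_zero, sum_empty, Nat.reduceMul, Nat.reduceAdd, e4]
  rcases h4 with h4 | h4 | h4 | h4
  · have h0 : (k - 1 - 0) % 4 = 3 := by omega
    have h1 : (k - 1 - 1) % 4 = 2 := by omega
    have h2 : (k - 1 - 2) % 4 = 1 := by omega
    have h3 : (k - 1 - 3) % 4 = 0 := by omega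
    have h5 : (k - 1 - 4) % 4 = 3 := by omega
    simp only [pairSum, mod4, h0, h1, h2, h3, h5, h4]; norm_num
  · have h0 : (k - 1 - 0) % 4 = 0 := by omega
    have h1 : (k - 1 - 1) % 4 = 3 := by omega
    have h2 : (k - 1 - 2) % 4 = 2 := by omega
    have h3 : (k - 1 - 3) % 4 = 1 := by omega
    have h5 : (k - 1 - 4) % 4 = 0 := by omega
    simp only [pairSum, mod4, h0, h1, h2, h3, h5, h4]; norm_num
  · have h0 : (k - 1 - 0) % 4 = 1 := by omega
    have h1 : (k - 1 - 1) % 4 = 0 := by omega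
    have h2 : (k - 1 - 2) % 4 = 3 := by omega
    have h3 : (k - 1 - 3) % 4 = 2 := by omega
    have h5 : (k - 1 - 4) % 4 = 1 := by omega
    simp only [pairSum, mod4, h0, h1, h2, h3, h5, h4]; norm_num
  · have h0 : (k - 1 - 0) % 4 = 2 := by omega
    have h1 : (k - 1 - 1) % 4 = 1 := by omega
    have h2 : (k - 1 - 2) % 4 = 0 := by omega
    have h3 : (k - 1 - 3) % 4 = 3 := by omega
    have h5 : (k - 1 - 4) % 4 = 2 := by omega
    simp only [pairSum, mod4, h0, h1, h2, h3, h5, h4]; norm_num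

/-- Two consecutive cells of the back diagonal lie in the two opposite columns of one level, which
turns the sum into a difference of neighbouring `pairSum` values. -/
theorem symEntry_add_symEntry {k t : ℕ} (h : 2 * t + 1 < k + 6) (hk : 7 ≤ k) :
    symEntry (2 * t) (2 * k + 12 - 2 * t) + symEntry (2 * t + 1) (2 * k + 12 - (2 * t + 1)) =
      pairSum (k - 1 - t) (2 * t + 1) - pairSum (k - 1 - t) (2 * t) := by
  rw [show 2 * k + 12 - 2 * t = 2 * (k - 1 - t) + 14 by omega,
    show 2 * k + 12 - (2 * t + 1) = 2 * (k - 1 - t) + 13 by omega,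
    symEntry_even (by omega), symEntry_odd (by omega)]
  ring

theorem sum_middle_rows {k n : ℕ} (h : 2 * n ≤ k - 7 + 1) (hk : 7 ≤ k) :
    ∑ t ∈ range n, (pairSum (k - 1 - (5 + t)) (2 * (5 + t) + 1) -
      pairSum (k - 1 - (5 + t)) (2 * (5 + t))) = if n % 2 = 0 then 0 else -2 := by
  rw [← sum_range_alternate]
  refine sum_congr rfl fun t ht => pairSum_alternate ?_
  have := mem_range.1 ht
  omega

/-- The innermost difference is -1 + (86 + 4(p + 1)) = 89 + 4p against the central entry -(88 + 4p).
The surplus 1 is absorbed by the first ten rows and the alternating middle part. -/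
theorem sum_symEntry_even (M p : ℕ) :
    ∑ i ∈ range (2 * p + 14), symEntry i (2 * (2 * p + 8) + 12 - i) +
      grownArray M (2 * p + 14) (2 * p + 14) = 0 := by
  rw [show 2 * p + 14 = 2 * (5 + (p + 1) + 1) by ring, sum_range_two_mul,
    sum_congr rfl fun t ht => symEntry_add_symEntry (k := 2 * p + 8) (t := t)
      (by have := mem_range.1 ht; omega) (by omega), sum_range_succ, sum_range_add,
    sum_first_rows (by omega), sum_middle_rows (by omega) (by omega), pairSum_last (by omega),
    pairSum_large (by omega) (by omega), show 2 * (5 + (p + 1) + 1) = 2 * p + 14 by ring,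
    grownArray_diag_even_even]
  have : p % 2 = 0 ∨ p % 2 = 1 := by omega
  rcases this with h | h
  · rw [mod4_of_zero (by omega), if_neg (by omega)]; omega
  · rw [mod4_of_two (by omega), if_pos (by omega)]; omega

/-- The large value -(86 + 4(p + 1)) of level p + 1 meets the central entry 88 + 4p; the small
discrepancy is removed by the outer rows and the neighbouring ±1 terms. -/
theorem sum_symEntry_odd (M p : ℕ) :
    ∑ i ∈ range (2 * p + 13), symEntry i (2 * (2 * p + 7) + 12 - i) +
      grownArray M (2 * p + 13) (2 * p + 13) = 0 := by
  rw [show 2 * p + 13 = 2 * (5 + p + 1) + 1 by ring, sum_range_succ, sum_range_two_mul,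
    sum_congr rfl fun t ht => symEntry_add_symEntry (k := 2 * p + 7) (t := t)
      (by have := mem_range.1 ht; omega) (by omega), sum_range_succ, sum_range_add,
    sum_first_rows (by omega), sum_middle_rows (by omega) (by omega),
    pairSum_large (by omega) (by omega), pairSum_generic (by omega) (by omega),
    show 2 * (2 * p + 7) + 12 - 2 * (5 + p + 1) = 2 * p + 14 by omega, symEntry_even (by omega),
    pairSum_last (by omega), show 2 * (5 + p + 1) + 1 = 2 * p + 13 by ring,
    grownArray_diag_odd_odd]
  have : p % 2 = 0 ∨ p % 2 = 1 := by omega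
  rcases this with h | h
  · rw [if_pos h, if_pos (by omega)]
    have : (2 * p + 7) % 4 = 1 ∨ (2 * p + 7) % 4 = 3 := by omega
    rcases this with h' | h'
    · rw [mod4_of_one h']; omega
    · rw [mod4_of_three h']; omega
  · rw [if_neg (by omega), if_neg (by omega)]
    have : (2 * p + 7) % 4 = 1 ∨ (2 * p + 7) % 4 = 3 := by omega
    rcases this with h' | h'
    · rw [mod4_of_one h']; omega
    · rw [mod4_of_three h']; omega

theorem sum_symEntry (M k : ℕ) :
    ∑ i ∈ range (k + 6), symEntry i (2 * k + 12 - i) + grownArray M (k + 6) (k + 6) = 0 := by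
  obtain h | h := lt_or_ge k 7
  -- The centre lies in the core, so nothing depends on `M` and seven cases remain to be evaluated.
  · rw [grownArray_core (by omega) (by omega)]
    revert k
    decide
  · obtain ⟨p, rfl | rfl⟩ : ∃ p, k = 2 * p + 7 ∨ k = 2 * p + 8 := ⟨(k - 7) / 2, by omega⟩
    · exact sum_symEntry_odd M p
    · exact sum_symEntry_even M p

theorem sum_backDiag_grownArray (M k : ℕ) :
    ∑ i ∈ range (2 * k + 13), grownArray M i (2 * k + 13 - 1 - i) = 0 := by
  rw [← sum_symEntry M k, show 2 * k + 13 = 2 * (k + 6) + 1 by ring, sum_range_fold_odd]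
  congr 1
  · refine sum_congr rfl fun i hi => ?_
    have := mem_range.1 hi
    rw [← grownArray_add_swap M (by omega)]
    congr 2; omega
  · congr 1; omega

/-! ### Back diagonals of the even-order blocks -/

theorem symEntry_shifted_add {k t : ℕ} (h : 2 * t + 4 ≤ k + 8) (hk : 4 ≤ k) :
    symEntry (3 + 2 * t) (3 + (2 * k + 11 - 2 * t)) +
      symEntry (3 + (2 * t + 1)) (3 + (2 * k + 11 - (2 * t + 1))) =
      pairSum (k - t) (2 * t + 4) - pairSum (k - t) (2 * t + 3) := by
  rw [show 3 + (2 * k + 11 - 2 * t) = 2 * (k - t) + 14 by omega,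
    show 3 + (2 * k + 11 - (2 * t + 1)) = 2 * (k - t) + 13 by omega,
    symEntry_even (by omega), symEntry_odd (by omega), show 3 + (2 * t + 1) = 2 * t + 4 by ring,
    add_comm 3]
  ring

/-- The shift by 3 pairs the indices 2t + 3 and 2t + 4, on which the pattern is constant: both
generic with equal sign, both large, or both final. -/
theorem pairSum_succ_sub {k t : ℕ} (h : 2 * t + 4 ≤ 2 * k + 12) (ht : 3 ≤ t) :
    pairSum k (2 * t + 4) - pairSum k (2 * t + 3) = 0 := by
  obtain h1 | h1 | h1 : 2 * t + 3 < 2 * k + 9 ∨ 2 * t + 3 = 2 * k + 9 ∨ 2 * t + 3 = 2 * k + 11 := by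
    omega
  · rw [pairSum_generic (by omega) (by omega), pairSum_generic (by omega) (by omega)]
    split_ifs <;> omega
  · rw [pairSum_large (by omega) (by omega), pairSum_large (by omega) (by omega), sub_self]
  · rw [pairSum_last (by omega), pairSum_last (by omega), sub_self]

theorem sum_shifted_pairs {k n : ℕ} (h : 2 * n ≤ k) (hk : 4 ≤ k) :
    ∑ t ∈ range (3 + n), (pairSum (k - t) (2 * t + 4) - pairSum (k - t) (2 * t + 3)) = 0 := by
  rw [sum_range_add, sum_eq_zero (s := range n) fun t ht => pairSum_succ_sub
    (by have := mem_range.1 ht; omega) (by omega), add_zero]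
  -- Only t = 0, 1, 2 involve irregular indices: t = 1 gives 0, while t = 0 at level k cancels t = 2
  -- at level k - 2.
  simp only [sum_range_succ, range_zero, sum_empty, Nat.reduceMul, Nat.reduceAdd]
  have h4 : k % 4 = 0 ∨ k % 4 = 1 ∨ k % 4 = 2 ∨ k % 4 = 3 := by omega
  rcases h4 with h4 | h4 | h4 | h4
  · have h2 : (k - 2) % 4 = 2 := by omega
    simp [pairSum, mod4, h4, h2]
  · have h2 : (k - 2) % 4 = 3 := by omega
    simp [pairSum, mod4, h4, h2]
  · have h2 : (k - 2) % 4 = 0 := by omega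
    simp [pairSum, mod4, h4, h2]
  · have h2 : (k - 2) % 4 = 1 := by omega
    simp [pairSum, mod4, h4, h2]

/-- For odd `k` the pairing leaves over the innermost transposed pair: the two opposite off-diagonal
entries of a corner. -/
theorem sum_symEntry_shifted (k : ℕ) :
    ∑ i ∈ range (k + 6), symEntry (3 + i) (3 + (2 * k + 11 - i)) = 0 := by
  obtain h | h := lt_or_ge k 4
  · revert k
    decide
  · obtain ⟨p, rfl | rfl⟩ : ∃ p, k = 2 * p + 4 ∨ k = 2 * p + 5 := ⟨(k - 4) / 2, by omega⟩
    · rw [show 2 * p + 4 + 6 = 2 * (3 + (p + 2)) by ring, sum_range_two_mul,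
        sum_congr rfl fun t ht => symEntry_shifted_add (k := 2 * p + 4) (t := t)
          (by have := mem_range.1 ht; omega) (by omega)]
      exact sum_shifted_pairs (by omega) (by omega)
    · rw [show 2 * p + 5 + 6 = 2 * (3 + (p + 2)) + 1 by ring, sum_range_succ, sum_range_two_mul,
        sum_congr rfl fun t ht => symEntry_shifted_add (k := 2 * p + 5) (t := t)
          (by have := mem_range.1 ht; omega) (by omega),
        sum_shifted_pairs (by omega) (by omega),
        show 3 + 2 * (3 + (p + 2)) = 2 * p + 13 by ring,
        show 3 + (2 * (2 * p + 5) + 11 - 2 * (3 + (p + 2))) = 2 * p + 14 by omega,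
        symEntry_odd_even, add_zero]

theorem sum_backDiag_grownArray_shifted (M k : ℕ) :
    ∑ i ∈ range (2 * k + 12), grownArray M (3 + i) (3 + (2 * k + 12 - 1 - i)) = 0 := by
  rw [← sum_symEntry_shifted k, show 2 * k + 12 = 2 * (k + 6) by ring, sum_range_fold_even]
  refine sum_congr rfl fun i hi => ?_
  have := mem_range.1 hi
  rw [← grownArray_add_swap M (by omega)]
  congr 2; omega

end backDiagonals

/-! ### The magic blocks and the entries of the growing construction -/

section grown

open Finset

theorem zeroBlock_odd (M k : ℕ) : ZeroBlock (grownArray M) (2 * k + 13) 0 0 := by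
  refine ⟨fun i hi => ?_, fun j hj => ?_, ?_, ?_⟩
  · simpa using sum_row_grownArray M k i hi
  · simpa using sum_col_grownArray M k j hj
  · simpa using sum_diag_grownArray M k
  · simpa using sum_backDiag_grownArray M k

/-- Remove three rows and columns from the leading block of order 2(k + 1) + 13; each line of the
rest loses a zero triple. -/
theorem zeroBlock_even (M k : ℕ) : ZeroBlock (grownArray M) (2 * k + 12) 3 3 := by
  have e : 2 * (k + 1) + 13 = 2 * k + 12 + 3 := by ring
  refine ⟨fun i hi => ?_, fun j hj => ?_, ?_, sum_backDiag_grownArray_shifted M k⟩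
  · have h := sum_row_grownArray M (k + 1) (3 + i) (by omega)
    rwa [e, sum_range_add_three, grownArray_row_triple M (by omega), zero_add] at h
  · have h := sum_col_grownArray M (k + 1) (3 + j) (by omega)
    rwa [e, sum_range_add_three, grownArray_col_triple M (by omega), zero_add] at h
  · have h := sum_diag_grownArray M (k + 1)
    rwa [e, sum_range_add_three, grownArray_diag_triple, zero_add] at h

theorem zeroBlock_congr {e e' : ℕ → ℕ → ℤ} {k r c : ℕ}
    (h : ∀ i < k, ∀ j < k, e (r + i) (c + j) = e' (r + i) (c + j)) (hz : ZeroBlock e' k r c) :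
    ZeroBlock e k r c := by
  obtain ⟨h1, h2, h3, h4⟩ := hz
  refine ⟨fun i hi => ?_, fun j hj => ?_, ?_, ?_⟩
  · rw [sum_congr rfl fun j hj => h i hi j (mem_range.1 hj), h1 i hi]
  · rw [sum_congr rfl fun i hi => h i (mem_range.1 hi) j hj, h2 j hj]
  · rw [sum_congr rfl fun i hi => h i (mem_range.1 hi) i (mem_range.1 hi), h3]
  · rw [sum_congr rfl fun i hi => h i (mem_range.1 hi) (k - 1 - i)
      (by have := mem_range.1 hi; omega), h4]

theorem coreTable_zeroBlock : ∀ k < 12, 3 ≤ k →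
    (cornerPosition k).1 + k ≤ 13 ∧ (cornerPosition k).2 + k ≤ 13 ∧
      ZeroBlock (tableArray coreTable) k (cornerPosition k).1 (cornerPosition k).2 := by
  decide +kernel

theorem coreTable_exhausts : Exhausts coreTable 84 := by decide +kernel

theorem exists_zeroBlock_grownArray (M k : ℕ) (h3 : 3 ≤ k) (hk : k + 2 ≤ 2 * M + 13) :
    ∃ r c, r + k ≤ 2 * M + 13 ∧ c + k ≤ 2 * M + 13 ∧ ZeroBlock (grownArray M) k r c := by
  obtain h | h := lt_or_ge k 12
  · obtain ⟨h1, h2, h⟩ := coreTable_zeroBlock k h h3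
    exact ⟨_, _, by omega, by omega, zeroBlock_congr
      (fun i hi j hj => grownArray_core (by omega) (by omega)) h⟩
  · obtain ⟨p, rfl | rfl⟩ : ∃ p, k = 2 * p + 12 ∨ k = 2 * p + 13 := ⟨(k - 12) / 2, by omega⟩
    · exact ⟨3, 3, by omega, by omega, zeroBlock_even M p⟩
    · exact ⟨0, 0, by omega, by omega, zeroBlock_odd M p⟩

/-! ### Every value is attained -/

/-- Both `v` and `-v` occur in the leading block of order `2 * M + 13`. -/
def Occurs (M : ℕ) (v : ℤ) : Prop :=
  (∃ i < 2 * M + 13, ∃ j < 2 * M + 13, grownArray M i j = v) ∧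
    ∃ i < 2 * M + 13, ∃ j < 2 * M + 13, grownArray M i j = -v

theorem Occurs.neg {M : ℕ} {v : ℤ} (h : Occurs M v) : Occurs M (-v) :=
  ⟨h.2, by rw [neg_neg]; exact h.1⟩

theorem occurs_colEntry {M k i : ℕ} (hk : k < M) (hi : i < 2 * k + 13) :
    Occurs M (colEntry M k i) :=
  ⟨⟨i, by omega, 2 * k + 13, by omega, grownArray_col_odd hi⟩,
    ⟨i, by omega, 2 * k + 14, by omega, grownArray_col_even hi⟩⟩

theorem occurs_rowEntry {M k i : ℕ} (hk : k < M) (hi : i < 2 * k + 13) :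
    Occurs M (rowEntry M k i) :=
  ⟨⟨2 * k + 13, by omega, i, by omega, grownArray_row_odd hi⟩,
    ⟨2 * k + 14, by omega, i, by omega, grownArray_row_even hi⟩⟩

theorem Occurs.of_eq_or_neg {M : ℕ} {v w : ℤ} (h : Occurs M v) (hv : v = w ∨ v = -w) :
    Occurs M w := by
  obtain rfl | rfl := hv
  · exact h
  · simpa using h.neg

theorem occurs_pairLow {M k i : ℕ} (hk : k < M) (hi : i < 2 * k + 13) :
    Occurs M (pairLow M k i) := by
  rcases pair_magnitudes M k i with ⟨h, -⟩ | ⟨h, -⟩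
  · exact (occurs_colEntry hk hi).of_eq_or_neg h
  · exact (occurs_rowEntry hk hi).of_eq_or_neg h

theorem occurs_pairLow_add {M k i : ℕ} (hk : k < M) (hi : i < 2 * k + 13) :
    Occurs M (pairLow M k i + pairGap k i) := by
  rcases pair_magnitudes M k i with ⟨-, h⟩ | ⟨-, h⟩
  · exact (occurs_rowEntry hk hi).of_eq_or_neg h
  · exact (occurs_colEntry hk hi).of_eq_or_neg h

theorem occurs_diag {M k : ℕ} (hk : k < M) : Occurs M (88 + 4 * k) :=
  ⟨⟨2 * k + 13, by omega, 2 * k + 13, by omega, grownArray_diag_odd_odd⟩,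
    ⟨2 * k + 14, by omega, 2 * k + 14, by omega, grownArray_diag_even_even⟩⟩

theorem occurs_offDiag {M k : ℕ} (hk : k < M) : Occurs M (86 + 4 * k) :=
  ⟨⟨2 * k + 13, by omega, 2 * k + 14, by omega, grownArray_diag_odd_even⟩,
    ⟨2 * k + 14, by omega, 2 * k + 13, by omega, grownArray_diag_even_odd⟩⟩

theorem occurs_core {M : ℕ} {v : ℤ} (h1 : -84 ≤ v) (h2 : v ≤ 84) : Occurs M v := by
  have key : ∀ w : ℤ, -84 ≤ w → w ≤ 84 →
      ∃ i < 2 * M + 13, ∃ j < 2 * M + 13, grownArray M i j = w := by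
    intro w h1 h2
    obtain ⟨i, hi, j, hj, h⟩ := coreTable_exhausts.exists_eq (n := 13) rfl (by decide)
      (v := w) (by exact_mod_cast h1) (by exact_mod_cast h2)
    exact ⟨i, by omega, j, by omega, by rw [grownArray_core hi hj, h]⟩
  exact ⟨key v h1 h2, key (-v) (by omega) (by omega)⟩

theorem two_mul_blockCount (k : ℕ) : 2 * blockCount k = k * (k + 5) := by
  induction k with
  | zero => rfl
  | succ k ih => rw [blockCount, mul_add, ih]; ring

theorem exists_eq_blockCount_add {M t : ℕ} (h : t < blockCount M) :
    ∃ k < M, ∃ s < k + 3, t = blockCount k + s := by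
  induction M with
  | zero => simp [blockCount] at h
  | succ M ih =>
    obtain h' | h' := lt_or_ge t (blockCount M)
    · obtain ⟨k, hk, s, hs, rfl⟩ := ih h'
      exact ⟨k, by omega, s, hs, rfl⟩
    · rw [blockCount] at h
      exact ⟨M, by omega, t - blockCount M, by omega, by omega⟩

/-- Level t / 4 fills four consecutive magnitudes: a pair of gap 2 in row or column 1 or 2
interlaces with the two corner magnitudes. -/
theorem occurs_zone {M t : ℕ} (h : t < 4 * M) : Occurs M (85 + t) := by
  have hk : t / 4 < M := by omega
  obtain ⟨i, hi3, hi⟩ : ∃ i < 3, pairLow M (t / 4) i = 85 + 4 * (t / 4 : ℕ) ∧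
      pairGap (t / 4) i = 2 := by
    have h4 : (t / 4) % 4 = 0 ∨ (t / 4) % 4 = 1 ∨ (t / 4) % 4 = 2 ∨ (t / 4) % 4 = 3 := by omega
    rcases h4 with h4 | h4 | h4 | h4
    · exact ⟨2, by omega, by simp [pairLow, pairGap, mod4, h4]⟩
    · exact ⟨2, by omega, by simp [pairLow, pairGap, mod4, h4]⟩
    · exact ⟨1, by omega, by simp [pairLow, pairGap, mod4, h4]⟩
    · exact ⟨1, by omega, by simp [pairLow, pairGap, mod4, h4]⟩
  have ht : t % 4 = 0 ∨ t % 4 = 1 ∨ t % 4 = 2 ∨ t % 4 = 3 := by omega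
  rcases ht with ht | ht | ht | ht
  · have := occurs_pairLow hk (show i < 2 * (t / 4) + 13 by omega)
    rw [hi.1] at this
    convert this using 1; omega
  · convert occurs_offDiag hk using 1; omega
  · have := occurs_pairLow_add hk (show i < 2 * (t / 4) + 13 by omega)
    rw [hi.1, hi.2] at this
    convert this using 1; omega
  · convert occurs_diag hk using 1; omega

theorem occurs_block {M t c : ℕ} (h : t < blockCount M) (hc : c < 4) :
    Occurs M (blockLow M t + c) := by
  obtain ⟨k, hk, s, hs, rfl⟩ := exists_eq_blockCount_add h
  have hl (i : ℕ) (h3 : 3 ≤ i) (h8 : i < 2 * k + 9) : pairLow M k i =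
      blockLow M (blockCount k + (i - 3) / 2) +
        (if i % 2 = 1 then 0 else if i = 6 then 1 else 2) := by
    unfold pairLow
    iterate 3 rw [if_neg (by omega)]
    rw [if_pos h8]
  have h1 := hl (2 * s + 3) (by omega) (by omega)
  have h2 := hl (2 * s + 4) (by omega) (by omega)
  rw [show (2 * s + 3 - 3) / 2 = s by omega, if_pos (by omega), add_zero] at h1
  rw [show (2 * s + 4 - 3) / 2 = s by omega, if_neg (by omega)] at h2
  have o1 := occurs_pairLow hk (show 2 * s + 3 < 2 * k + 13 by omega)
  have o2 := occurs_pairLow hk (show 2 * s + 4 < 2 * k + 13 by omega)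
  have o3 := occurs_pairLow_add hk (show 2 * s + 3 < 2 * k + 13 by omega)
  have o4 := occurs_pairLow_add hk (show 2 * s + 4 < 2 * k + 13 by omega)
  rw [h1] at o1 o3
  rw [h2] at o2 o4
  -- The block of indices 5 and 6 has gaps 2 and splits as {0, 2}, {1, 3}; all others split as {0,
  -- 1}, {2, 3}.
  obtain rfl | hs1 := eq_or_ne s 1
  · have g1 : pairGap k (2 * 1 + 3) = 2 := by simp [pairGap]
    have g2 : pairGap k (2 * 1 + 4) = 2 := by simp [pairGap]
    rw [g1] at o3
    rw [g2] at o4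
    interval_cases c
    · simpa using o1
    · simpa using o2
    · simpa using o3
    · simpa [add_assoc] using o4
  · have g (i : ℕ) (h3 : 3 ≤ i) (h5 : i ≠ 5) (h6 : i ≠ 6) (h8 : i < 2 * k + 9) :
        pairGap k i = 1 := by
      unfold pairGap
      iterate 3 rw [if_neg (by omega)]
      split_ifs <;> rfl
    rw [g _ (by omega) (by omega) (by omega) (by omega)] at o3 o4
    rw [if_neg (by omega)] at o2 o4
    interval_cases c
    · simpa using o1
    · simpa using o3
    · simpa using o2
    · simpa [add_assoc] using o4

/-- The lower flanks are supplied by index 0, by the smaller magnitudes at the two large-gap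
indices, and by index 2k + 11. -/
theorem occurs_family_low {M k f c : ℕ} (hk : k < M) (hf : f < 3) (hc : c < 2) :
    Occurs M ((85 + 4 * M : ℤ) + f * (4 * M + 84) + 2 * (M - 1 - k) + c) := by
  interval_cases f
  · have h : pairLow M k 0 = (85 + 4 * M : ℤ) + 2 * (M - 1 - k) := by simp [pairLow]
    have hg : pairGap k 0 = 1 := by simp [pairGap]
    have o1 := occurs_pairLow hk (show 0 < 2 * k + 13 by omega)
    have o2 := occurs_pairLow_add hk (show 0 < 2 * k + 13 by omega)
    rw [h] at o1 o2
    rw [hg] at o2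
    interval_cases c
    · simpa using o1
    · simpa using o2
  · have h1 : pairLow M k (2 * k + 9) = (85 + 4 * M : ℤ) + (4 * M + 84) + 2 * (M - 1 - k) := by
      unfold pairLow
      iterate 4 rw [if_neg (by omega)]
      rw [if_pos rfl]
    have h2 : pairLow M k (2 * k + 10) =
        (85 + 4 * M : ℤ) + (4 * M + 84) + 2 * (M - 1 - k) + 1 := by
      unfold pairLow
      iterate 5 rw [if_neg (by omega)]
      rw [if_pos rfl]
    have o1 := occurs_pairLow hk (show 2 * k + 9 < 2 * k + 13 by omega)
    have o2 := occurs_pairLow hk (show 2 * k + 10 < 2 * k + 13 by omega)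
    rw [h1] at o1
    rw [h2] at o2
    interval_cases c
    · simpa using o1
    · simpa using o2
  · have h : pairLow M k (2 * k + 11) =
        (85 + 4 * M : ℤ) + 2 * (4 * M + 84) + 2 * (M - 1 - k) := by
      unfold pairLow
      iterate 6 rw [if_neg (by omega)]
      rw [if_pos rfl]
    have hg : pairGap k (2 * k + 11) = 1 := by
      unfold pairGap
      iterate 9 rw [if_neg (by omega)]
    have o1 := occurs_pairLow hk (show 2 * k + 11 < 2 * k + 13 by omega)
    have o2 := occurs_pairLow_add hk (show 2 * k + 11 < 2 * k + 13 by omega)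
    rw [h] at o1 o2
    rw [hg] at o2
    interval_cases c
    · simpa using o1
    · simpa using o2

theorem occurs_family_high {M k f c : ℕ} (hk : k < M) (hf : f < 3) (hc : c < 2) :
    Occurs M ((85 + 4 * M : ℤ) + f * (4 * M + 84) + (2 * M + 84 + 2 * k) + c) := by
  interval_cases f
  · obtain ⟨i, hi3, h, hg⟩ : ∃ i < 3, pairLow M k i = (85 + 4 * M : ℤ) + (2 * M + 84 + 2 * k) ∧
        pairGap k i = 1 := by
      have h4 : k % 4 = 0 ∨ k % 4 = 1 ∨ k % 4 = 2 ∨ k % 4 = 3 := by omega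
      rcases h4 with h4 | h4 | h4 | h4
      · exact ⟨1, by omega, by simp [pairLow, pairGap, mod4, h4]⟩
      · exact ⟨1, by omega, by simp [pairLow, pairGap, mod4, h4]⟩
      · exact ⟨2, by omega, by simp [pairLow, pairGap, mod4, h4]⟩
      · exact ⟨2, by omega, by simp [pairLow, pairGap, mod4, h4]⟩
    have o1 := occurs_pairLow hk (show i < 2 * k + 13 by omega)
    have o2 := occurs_pairLow_add hk (show i < 2 * k + 13 by omega)
    rw [h] at o1 o2
    rw [hg] at o2
    interval_cases c
    · simpa using o1
    · simpa using o2
  -- In the middle family one pair reaches both flanks: 2(M - 1 - k) + (86 + 4k) = 2M + 84 + 2k.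
  · have h1 : pairLow M k (2 * k + 9) = (85 + 4 * M : ℤ) + (4 * M + 84) + 2 * (M - 1 - k) := by
      unfold pairLow
      iterate 4 rw [if_neg (by omega)]
      rw [if_pos rfl]
    have h2 : pairLow M k (2 * k + 10) =
        (85 + 4 * M : ℤ) + (4 * M + 84) + 2 * (M - 1 - k) + 1 := by
      unfold pairLow
      iterate 5 rw [if_neg (by omega)]
      rw [if_pos rfl]
    have hg (i : ℕ) (h9 : 2 * k + 9 ≤ i) (h11 : i < 2 * k + 11) : pairGap k i = 86 + 4 * k := by
      unfold pairGap
      iterate 8 rw [if_neg (by omega)]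
      rw [if_pos h11]
    have o1 := occurs_pairLow_add hk (show 2 * k + 9 < 2 * k + 13 by omega)
    have o2 := occurs_pairLow_add hk (show 2 * k + 10 < 2 * k + 13 by omega)
    rw [h1, hg _ (by omega) (by omega)] at o1
    rw [h2, hg _ (by omega) (by omega)] at o2
    interval_cases c
    · convert o1 using 1; push_cast; ring
    · convert o2 using 1; push_cast; ring
  · have h : pairLow M k (2 * k + 12) =
        (85 + 4 * M : ℤ) + 2 * (4 * M + 84) + (2 * M + 84 + 2 * k) := by
      unfold pairLow
      iterate 7 rw [if_neg (by omega)]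
    have hg : pairGap k (2 * k + 12) = 1 := by
      unfold pairGap
      iterate 9 rw [if_neg (by omega)]
    have o1 := occurs_pairLow hk (show 2 * k + 12 < 2 * k + 13 by omega)
    have o2 := occurs_pairLow_add hk (show 2 * k + 12 < 2 * k + 13 by omega)
    rw [h] at o1 o2
    rw [hg] at o2
    interval_cases c
    · simpa using o1
    · simpa using o2

/-- Each family is a lower flank of 2M, a middle of 84 = 4 · 21, and an upper flank of 2M; the three
middles consume 63 blocks. -/
theorem occurs_family {M f u : ℕ} (hM : 63 ≤ blockCount M) (hf : f < 3) (hu : u < 4 * M + 84) :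
    Occurs M ((85 + 4 * M : ℤ) + f * (4 * M + 84) + u) := by
  obtain h | h := lt_or_ge u (2 * M)
  · convert occurs_family_low (M := M) (k := M - 1 - u / 2) (f := f) (c := u % 2) (by omega) hf
      (by omega) using 1
    generalize (f : ℤ) * (4 * M + 84) = x
    omega
  · obtain h' | h' := lt_or_ge u (2 * M + 84)
    · have o := occurs_block (M := M) (t := 21 * f + (u - 2 * M) / 4) (c := (u - 2 * M) % 4)
        (by omega) (by omega)
      rw [blockLow, if_pos (by omega), show (21 * f + (u - 2 * M) / 4) / 21 = f by omega] at o
      convert o using 1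
      generalize (f : ℤ) * (4 * M + 84) = x
      omega
    · convert occurs_family_high (M := M) (k := (u - 2 * M - 84) / 2) (f := f)
        (c := (u - 2 * M - 84) % 2) (by omega) hf (by omega) using 1
      generalize (f : ℤ) * (4 * M + 84) = x
      omega

theorem occurs_of_le {M : ℕ} (hM : 10 ≤ M) {t : ℕ} (ht : t ≤ 2 * ((M + 6) * (M + 7))) :
    Occurs M t := by
  have hb := two_mul_blockCount M
  -- `blockCount M` equals M(M + 5)/2, already 75 for M = 10.
  have h63 : 63 ≤ blockCount M := by nlinarith
  have hN : 2 * ((M + 6) * (M + 7)) = 4 * blockCount M + 16 * M + 84 := by nlinarith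
  rw [hN] at ht
  obtain h | h := lt_or_ge t 85
  · exact occurs_core (by omega) (by omega)
  obtain h1 | h1 := lt_or_ge t (85 + 4 * M)
  · convert occurs_zone (M := M) (t := t - 85) (by omega) using 1; omega
  obtain h2 | h2 := lt_or_ge t (85 + 4 * M + (4 * M + 84))
  · convert occurs_family (M := M) (f := 0) (u := t - (85 + 4 * M)) h63 (by omega) (by omega)
      using 1
    omega
  obtain h3 | h3 := lt_or_ge t (85 + 4 * M + 2 * (4 * M + 84))
  · convert occurs_family (M := M) (f := 1) (u := t - (85 + 4 * M) - (4 * M + 84)) h63 (by omega)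
      (by omega) using 1
    omega
  obtain h4 | h4 := lt_or_ge t (85 + 4 * M + 3 * (4 * M + 84))
  · convert occurs_family (M := M) (f := 2) (u := t - (85 + 4 * M) - 2 * (4 * M + 84)) h63
      (by omega) (by omega) using 1
    omega
  · have o := occurs_block (M := M) (t := 63 + (t - (85 + 4 * M) - 3 * (4 * M + 84)) / 4)
      (c := (t - (85 + 4 * M) - 3 * (4 * M + 84)) % 4) (by omega) (by omega)
    rw [blockLow, if_neg (by omega)] at o
    convert o using 1
    omega

theorem isASMS_grownArray {M : ℕ} (hM : 10 ≤ M) :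
    IsASMS (leadingBlock (2 * M + 13) (grownArray M)) := by
  refine isASMS_leadingBlock (N := 2 * ((M + 6) * (M + 7))) (by ring) (zeroBlock_odd M M)
    (fun v h1 h2 => ?_) (fun k h3 hk => exists_zeroBlock_grownArray M k h3 hk)
  have o := occurs_of_le hM (t := v.natAbs) (by omega)
  obtain h | h := Int.natAbs_eq v
  · rw [← h] at o
    exact o.1
  · have := o.2
    rwa [← h] at this

end grown

theorem theorem1p1 (n : ℕ) (hn : (n : ℤ) ≡ 3 [ZMOD 18] ∨ (n : ℤ) ≡ -3 [ZMOD 18]) :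
    ∃ A : Matrix (Fin n) (Fin n) ℤ, IsASMS A := by
  have hmod : n % 18 = 3 ∨ n % 18 = 15 := by
    simp only [Int.ModEq] at hn
    omega
  -- The next admissible order after 3, 15 and 21 is 33, where M = 10.
  obtain rfl | rfl | rfl | ⟨M, hM, rfl⟩ :
      n = 3 ∨ n = 15 ∨ n = 21 ∨ ∃ M, 10 ≤ M ∧ n = 2 * M + 13 := by
    by_cases h : n < 33
    · omega
    · exact Or.inr (Or.inr (Or.inr ⟨(n - 13) / 2, by omega, by omega⟩))
  · exact exists_isASMS_three
  · exact exists_isASMS_fifteen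
  · exact exists_isASMS_twentyOne
  · exact ⟨_, isASMS_grownArray hM⟩
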